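/- Let $A=(a_1,\dots,a_n)$ be a row of integers with $1=a_1<a_2<\cdots<a_n$, and let $i\in\{2,\dots,n\}$. Let $A_n=\mathbb C\langle x_1,\dots,x_n,\partial_1,\dots,\partial_n\rangle$ be the $n$-th complex Weyl algebra, let $I_A\subset\mathbb C[\partial_1,\dots,\partial_n]\subset A_n$ be the toric ideal generated by all $\partial^u-\partial^v$ with $u,v\in\mathbb N^n$ and $\sum_j a_ju_j=\sum_j a_jv_j$, and put $A\theta=\sum_j a_jx_j\partial_j$. For a central indeterminate $s$ let $H_A[s]$ be the left ideal of $A_n[s]$ generated by $I_A$ and $A\theta-s$; for $\beta\in\mathbb C$ let $H_A(\beta)$ be the left ideal of $A_n$ generated by $I_A$ and $A\theta-\beta$. Let $A'=(a_1,\dots,a_{i-1},a_{i+1},\dots,a_n)$, and let $D'$ be the Weyl algebra in the $x_j,\partial_j$ with $j\neq i$, regarded as a subring of $A_n$. Define $H_{A'}[s]\subset D'[s]$ and $H_{A'}(\beta)\subset D'$ in the same way from $A'$. Then there is an isomorphism of left $D'[s]$-modules $$A_n[s]/\bigl(A_n[s]H_A[s]+x_iA_n[s]\bigr)\;\simeq\;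 D'[s]/D'[s]H_{A'}[s],$$ and for every $\beta\in\mathbb C$ there is an isomorphism of left $D'$-modules $$A_n/\bigl(A_nH_A(\beta)+x_iA_n\bigr)\;\simeq\; D'/D'H_{A'}(\beta),$$ that is, the restriction to $x_i=0$ of the GKZ system $A_n/H_A(\beta)$ is the GKZ system for $A'$. -/

import Mathlib

open scoped Polynomial

noncomputable section

/-- The defining relations of the Weyl algebra in the variables `x j` (`Sum.inl j`) and
`∂ j` (`Sum.inr j`), `j : σ`. -/
inductive WeylRel (σ : Type*) : FreeAlgebra ℂ (σ ⊕ σ) → FreeAlgebra ℂ (σ ⊕ σ) → Prop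
  | x_comm (j k : σ) : WeylRel σ
      (FreeAlgebra.ι ℂ (Sum.inl j) * FreeAlgebra.ι ℂ (Sum.inl k))
      (FreeAlgebra.ι ℂ (Sum.inl k) * FreeAlgebra.ι ℂ (Sum.inl j))
  | d_comm (j k : σ) : WeylRel σ
      (FreeAlgebra.ι ℂ (Sum.inr j) * FreeAlgebra.ι ℂ (Sum.inr k))
      (FreeAlgebra.ι ℂ (Sum.inr k) * FreeAlgebra.ι ℂ (Sum.inr j))
  | d_x_of_ne (j k : σ) (h : j ≠ k) : WeylRel σ
      (FreeAlgebra.ι ℂ (Sum.inr j) * FreeAlgebra.ι ℂ (Sum.inl k))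
      (FreeAlgebra.ι ℂ (Sum.inl k) * FreeAlgebra.ι ℂ (Sum.inr j))
  | d_x_self (j : σ) : WeylRel σ
      (FreeAlgebra.ι ℂ (Sum.inr j) * FreeAlgebra.ι ℂ (Sum.inl j))
      (FreeAlgebra.ι ℂ (Sum.inl j) * FreeAlgebra.ι ℂ (Sum.inr j) + 1)

/-- The Weyl algebra `ℂ⟨x j, ∂ j : j ∈ σ⟩` over the complex numbers, by generators and relations. -/
def WeylAlgebra (σ : Type*) : Type _ := RingQuot (WeylRel σ)

namespace WeylAlgebra

instance instRing (σ : Type*) : Ring (WeylAlgebra σ) := inferInstanceAs (Ring (RingQuot (WeylRel σ)))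

instance instAlgebra (σ : Type*) : Algebra ℂ (WeylAlgebra σ) :=
  inferInstanceAs (Algebra ℂ (RingQuot (WeylRel σ)))

variable {σ τ : Type*}

/-- The multiplication operator `x j`. -/
def x (j : σ) : WeylAlgebra σ :=
  RingQuot.mkAlgHom ℂ (WeylRel σ) (FreeAlgebra.ι ℂ (Sum.inl j))

/-- The partial derivative `∂ j`. -/
def d (j : σ) : WeylAlgebra σ :=
  RingQuot.mkAlgHom ℂ (WeylRel σ) (FreeAlgebra.ι ℂ (Sum.inr j))

theorem x_mul_x (j k : σ) : x j * x k = x k * x j := by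
  have h := RingQuot.mkAlgHom_rel ℂ (WeylRel.x_comm j k)
  rw [map_mul, map_mul] at h
  exact h

theorem d_mul_d (j k : σ) : d j * d k = d k * d j := by
  have h := RingQuot.mkAlgHom_rel ℂ (WeylRel.d_comm j k)
  rw [map_mul, map_mul] at h
  exact h

theorem d_mul_x_of_ne {j k : σ} (hjk : j ≠ k) : d j * x k = x k * d j := by
  have h := RingQuot.mkAlgHom_rel ℂ (WeylRel.d_x_of_ne j k hjk)
  rw [map_mul, map_mul] at h
  exact h

theorem d_mul_x_self (j : σ) : d j * x j = x j * d j + 1 := by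
  have h := RingQuot.mkAlgHom_rel ℂ (WeylRel.d_x_self j)
  rw [map_add, map_mul, map_mul, map_one] at h
  exact h

/-- The universal property of the Weyl algebra. -/
def lift {B : Type*} [Ring B] [Algebra ℂ B] (X D : σ → B)
    (hXX : ∀ j k, X j * X k = X k * X j) (hDD : ∀ j k, D j * D k = D k * D j)
    (hDX : ∀ j k, j ≠ k → D j * X k = X k * D j) (hDX' : ∀ j, D j * X j = X j * D j + 1) :
    WeylAlgebra σ →ₐ[ℂ] B :=
  RingQuot.liftAlgHom ℂ ⟨FreeAlgebra.lift ℂ (Sum.elim X D), by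
    intro p q h
    cases h with
    | x_comm j k => simpa using hXX j k
    | d_comm j k => simpa using hDD j k
    | d_x_of_ne j k h => simpa using hDX j k h
    | d_x_self j => simpa using hDX' j⟩

section lift

variable {B : Type*} [Ring B] [Algebra ℂ B] (X D : σ → B)
    (hXX : ∀ j k, X j * X k = X k * X j) (hDD : ∀ j k, D j * D k = D k * D j)
    (hDX : ∀ j k, j ≠ k → D j * X k = X k * D j) (hDX' : ∀ j, D j * X j = X j * D j + 1)

theorem lift_x (j : σ) : lift X D hXX hDD hDX hDX' (x j) = X j := by
  unfold lift x
  erw [RingQuot.liftAlgHom_mkAlgHom_apply]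
  simp

theorem lift_d (j : σ) : lift X D hXX hDD hDX hDX' (d j) = D j := by
  unfold lift d
  erw [RingQuot.liftAlgHom_mkAlgHom_apply]
  simp

end lift

theorem algHom_ext {B : Type*} [Ring B] [Algebra ℂ B] {f g : WeylAlgebra σ →ₐ[ℂ] B}
    (hx : ∀ j, f (x j) = g (x j)) (hd : ∀ j, f (d j) = g (d j)) : f = g := by
  apply RingQuot.ringQuot_ext' ℂ f g
  apply FreeAlgebra.hom_ext
  funext j
  cases j with
  | inl j => exact hx j
  | inr j => exact hd j

/-- The inclusion `D' → D` of the Weyl algebra without `x i`, `∂ i`. -/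
def incl (i : σ) : WeylAlgebra {j : σ // j ≠ i} →ₐ[ℂ] WeylAlgebra σ :=
  lift (fun j => x j.1) (fun j => d j.1) (fun _ _ => x_mul_x _ _) (fun _ _ => d_mul_d _ _)
    (fun _ _ h => d_mul_x_of_ne fun h' => h (Subtype.ext h')) (fun _ => d_mul_x_self _)

theorem x_mul_incl (i : σ) (p : WeylAlgebra {j : σ // j ≠ i}) :
    x i * incl i p = incl i p * x i := by
  have key : ∀ q : FreeAlgebra ℂ ({j : σ // j ≠ i} ⊕ {j : σ // j ≠ i}),
      Commute (x i) (incl i (RingQuot.mkAlgHom ℂ (WeylRel {j : σ // j ≠ i}) q)) := by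
    intro q
    induction q using FreeAlgebra.induction with
    | grade0 r =>
      rw [AlgHom.commutes]
      erw [AlgHom.commutes]
      exact (Algebra.commutes r (x i)).symm
    | grade1 j =>
      cases j with
      | inl j =>
        have h : incl i (x j) = x j.1 := lift_x _ _ _ _ _ _ j
        change Commute (x i) (incl i (x j))
        rw [h]
        exact x_mul_x _ _
      | inr j =>
        have h : incl i (d j) = d j.1 := lift_d _ _ _ _ _ _ j
        change Commute (x i) (incl i (d j))
        rw [h]
        exact (d_mul_x_of_ne j.2).symm
    | mul a b ha hb =>
      rw [map_mul]
      erw [map_mul]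
      exact ha.mul_right hb
    | add a b ha hb =>
      rw [map_add]
      erw [map_add]
      exact ha.add_right hb
  obtain ⟨q, rfl⟩ := RingQuot.mkAlgHom_surjective ℂ (WeylRel {j : σ // j ≠ i}) p
  exact key q

/-- The Weyl algebra `D` as a left module over `D'`, by left multiplication. -/
instance instModuleIncl (i : σ) : Module (WeylAlgebra {j : σ // j ≠ i}) (WeylAlgebra σ) :=
  Module.compHom _ (incl i).toRingHom

theorem smul_def (i : σ) (r : WeylAlgebra {j : σ // j ≠ i}) (p : WeylAlgebra σ) :
    r • p = incl i r * p := rfl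

instance instTowerIncl (i : σ) :
    IsScalarTower (WeylAlgebra {j : σ // j ≠ i}) (WeylAlgebra σ) (WeylAlgebra σ) :=
  ⟨fun r p q => mul_assoc (incl i r) p q⟩

/-- `D[s]` as a left module over `D'[s]`, by left multiplication. -/
instance instModulePolyIncl (i : σ) :
    Module (WeylAlgebra {j : σ // j ≠ i})[X] (WeylAlgebra σ)[X] :=
  Module.compHom _ (Polynomial.mapRingHom (incl i).toRingHom)

theorem poly_smul_def (i : σ) (r : (WeylAlgebra {j : σ // j ≠ i})[X]) (p : (WeylAlgebra σ)[X]) :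
    r • p = Polynomial.mapRingHom (incl i).toRingHom r * p := rfl

instance instTowerPolyIncl (i : σ) :
    IsScalarTower (WeylAlgebra {j : σ // j ≠ i})[X] (WeylAlgebra σ)[X] (WeylAlgebra σ)[X] :=
  ⟨fun r p q => mul_assoc (Polynomial.mapRingHom (incl i).toRingHom r) p q⟩

theorem x_mul_smul (i : σ) (r : WeylAlgebra {j : σ // j ≠ i}) (p : WeylAlgebra σ) :
    x i * (r • p) = r • (x i * p) := by
  rw [smul_def, smul_def, ← mul_assoc, x_mul_incl, mul_assoc]

theorem C_x_mul_smul (i : σ) (r : (WeylAlgebra {j : σ // j ≠ i})[X]) (p : (WeylAlgebra σ)[X]) :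
    Polynomial.C (x i) * (r • p) = r • (Polynomial.C (x i) * p) := by
  have h : Polynomial.C (x i) * Polynomial.mapRingHom (incl i).toRingHom r =
      Polynomial.mapRingHom (incl i).toRingHom r * Polynomial.C (x i) := by
    ext n
    simpa using x_mul_incl i (r.coeff n)
  rw [poly_smul_def, poly_smul_def, ← mul_assoc, h, mul_assoc]

/-- The subring `ℂ[∂]` of operators with constant coefficients. -/
def constCoeff (σ : Type*) : Subalgebra ℂ (WeylAlgebra σ) :=
  Algebra.adjoin ℂ (Set.range d)

theorem isMulCommutative_constCoeff (σ : Type*) : IsMulCommutative (constCoeff σ) :=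
  Algebra.isMulCommutative_adjoin ℂ (by
    rintro _ ⟨j, rfl⟩ _ ⟨k, rfl⟩
    exact d_mul_d j k)

instance instCommRingConstCoeff (σ : Type*) : CommRing (constCoeff σ) :=
  { (inferInstance : Ring (constCoeff σ)) with
    mul_comm := (isMulCommutative_constCoeff σ).is_comm.comm }

/-- `∂ j` as an element of `ℂ[∂]`. -/
def dConst (j : σ) : constCoeff σ := ⟨d j, Algebra.subset_adjoin ⟨j, rfl⟩⟩

variable [Fintype σ]

/-- The toric ideal `I_A ⊆ ℂ[∂]` of the one-row integer matrix `A`. -/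
def toricIdeal (A : σ → ℤ) : Ideal (constCoeff σ) :=
  Ideal.span {p | ∃ u v : σ → ℕ, ∑ j, A j * (u j : ℤ) = ∑ j, A j * (v j : ℤ) ∧
    p = ∏ j, dConst j ^ u j - ∏ j, dConst j ^ v j}

/-- `A θ = ∑ j, A j • x j ∂ j`. -/
def euler (A : σ → ℤ) : WeylAlgebra σ := ∑ j, A j • (x j * d j)

/-- The left ideal `H_A(β)` of `D` generated by `I_A` and `A θ - β`. -/
def gkz (A : σ → ℤ) (β : ℂ) : Submodule (WeylAlgebra σ) (WeylAlgebra σ) :=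
  Submodule.span (WeylAlgebra σ)
    ((fun p : constCoeff σ => (p : WeylAlgebra σ)) '' (toricIdeal A : Set (constCoeff σ)) ∪
      {euler A - algebraMap ℂ (WeylAlgebra σ) β})

/-- The left ideal `H_A[s]` of `D[s]` generated by `I_A` and `A θ - s`; the central
indeterminate `s` is `Polynomial.X`. -/
def gkzPoly (A : σ → ℤ) : Submodule (WeylAlgebra σ)[X] (WeylAlgebra σ)[X] :=
  Submodule.span (WeylAlgebra σ)[X]
    ((fun p : constCoeff σ => Polynomial.C (p : WeylAlgebra σ)) ''
        (toricIdeal A : Set (constCoeff σ)) ∪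
      {Polynomial.C (euler A) - Polynomial.X})

end WeylAlgebra

/-- For a left ideal `J` of `S` and `y ∈ S` such that left multiplication by `y` is `R`-linear,
the `R`-submodule `J + y S` of `S`. -/
def leftAddRight (R : Type*) {S : Type*} [Ring R] [Ring S] [Module R S] [IsScalarTower R S S]
    (J : Submodule S S) (y : S) (hy : ∀ (r : R) (p : S), y * (r • p) = r • (y * p)) :
    Submodule R S where
  carrier := {p | ∃ h ∈ J, ∃ q : S, p = h + y * q}
  zero_mem' := ⟨0, J.zero_mem, 0, by simp⟩
  add_mem' := by
    rintro _ _ ⟨h, hh, q, rfl⟩ ⟨h', hh', q', rfl⟩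
    exact ⟨h + h', J.add_mem hh hh', q + q', by rw [mul_add]; abel⟩
  smul_mem' := by
    rintro r _ ⟨h, hh, q, rfl⟩
    refine ⟨r • h, ?_, r • q, by rw [smul_add, hy]⟩
    have := J.smul_mem (r • (1 : S)) hh
    rwa [smul_assoc, one_smul] at this

namespace WeylAlgebra

variable {σ : Type*} [Fintype σ]

/-- The restriction `D / (D H_A(β) + x i D)` of `H_A(β)` to `x i = 0`, a left `D'`-module. -/
abbrev Restriction (A : σ → ℤ) (β : ℂ) (i : σ) : Type _ :=
  WeylAlgebra σ ⧸ leftAddRight (WeylAlgebra {j : σ // j ≠ i}) (gkz A β) (x i) (x_mul_smul i)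

/-- `D[s] / (D[s] H_A[s] + x i D[s])`, a left `D'[s]`-module. -/
abbrev RestrictionPoly (A : σ → ℤ) (i : σ) : Type _ :=
  (WeylAlgebra σ)[X] ⧸ leftAddRight (WeylAlgebra {j : σ // j ≠ i})[X] (gkzPoly A)
    (Polynomial.C (x i)) (C_x_mul_smul i)

end WeylAlgebra

end

noncomputable section

open Polynomial (C X derivative)
open MulOpposite (op unop)

namespace WeylAlgebra

/-! Write `r = ∂_o ^ m`, where `a_o = 1` and `m = a_i`. The binomial `∂_i - r` lies in `I_A`, so
`∂_i` can be eliminated. Modulo `x_i D` every operator is a polynomial in `∂_i` with coefficients in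
`D'` on the left, and modulo `D(∂_i - r)` it then becomes an element of `D'`. This gives a left
`D'`-linear map `restrictMap : D → D'` that kills `x_i D` and `D(∂_i - r)`.

To descend, this map must carry right multiplication by generators of `H_A` to right multiplication
by elements of `H_{A'}`. For toric binomials this holds because `∂_i ↦ ∂_o ^ m` preserves the
`A`-degree (`exists_mem_toricIdeal_restrictMap`). For the Euler operator, the contribution of `a_i
x_i ∂_i` is exactly the commutator of a power of `r` with the Euler operator of `A'`
(`restrictMap_mul_euler`).

Conversely `H_{A'}` lies in `H_A + x_i D`, so `1 ↦ 1` defines the inverse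
(`quotientLeftAddRightEquiv`). The version with `s` applies the same map to each coefficient. -/

@[elab_as_elim]
theorem induction_on {σ : Type*} {motive : WeylAlgebra σ → Prop} (p : WeylAlgebra σ)
    (algebraMap : ∀ c : ℂ, motive (algebraMap ℂ (WeylAlgebra σ) c))
    (x : ∀ j, motive (x j)) (d : ∀ j, motive (d j))
    (mul : ∀ p q, motive p → motive q → motive (p * q))
    (add : ∀ p q, motive p → motive q → motive (p + q)) : motive p := by
  have key : ∀ q : FreeAlgebra ℂ (σ ⊕ σ), motive (RingQuot.mkAlgHom ℂ (WeylRel σ) q) := by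
    intro q
    induction q using FreeAlgebra.induction with
    | grade0 r =>
      erw [AlgHom.commutes]
      exact algebraMap r
    | grade1 j =>
      cases j with
      | inl j => exact x j
      | inr j => exact d j
    | mul a b ha hb =>
      erw [map_mul]
      exact mul _ _ ha hb
    | add a b ha hb =>
      erw [map_add]
      exact add _ _ ha hb
  obtain ⟨q, rfl⟩ := RingQuot.mkAlgHom_surjective ℂ (WeylRel σ) p
  exact key q

/-! ### Commutation relations -/

variable {σ : Type*}

theorem incl_x (i : σ) (j : {j : σ // j ≠ i}) : incl i (x j) = x j.1 :=
  lift_x _ _ _ _ _ _ j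

theorem incl_d (i : σ) (j : {j : σ // j ≠ i}) : incl i (d j) = d j.1 :=
  lift_d _ _ _ _ _ _ j

theorem commute_d_incl (i : σ) (p : WeylAlgebra {j : σ // j ≠ i}) :
    Commute (d i) (incl i p) := by
  induction p using induction_on with
  | algebraMap c =>
    rw [AlgHom.commutes]
    exact (Algebra.commutes c (d i)).symm
  | x j =>
    rw [incl_x]
    exact d_mul_x_of_ne j.2.symm
  | d j =>
    rw [incl_d]
    exact d_mul_d _ _
  | mul p q hp hq =>
    rw [map_mul]
    exact hp.mul_right hq
  | add p q hp hq =>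
    rw [map_add]
    exact hp.add_right hq

theorem d_pow_mul_x_self (j : σ) (m : ℕ) : d j ^ m * x j = x j * d j ^ m + m • d j ^ (m - 1) := by
  induction m with
  | zero => simp
  | succ m ih =>
    rw [pow_succ', mul_assoc, ih, mul_add, ← mul_assoc, d_mul_x_self, mul_smul_comm]
    rcases m with _ | m
    · simp
    · simp only [Nat.add_sub_cancel, ← pow_succ', add_mul, one_mul, mul_assoc]
      rw [succ_nsmul _ (m + 1)]
      abel

theorem d_pow_mul_x_of_ne {j k : σ} (h : j ≠ k) (m : ℕ) : d j ^ m * x k = x k * d j ^ m :=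
  (show Commute (d j) (x k) from d_mul_x_of_ne h).pow_left m

/-- Only the summand `x_j ∂_j` fails to commute with `∂_j ^ m`. Used with `j = o`, this is the
commutator that balances `a_i x_i ∂_i`. -/
theorem d_pow_mul_euler [Fintype σ] [DecidableEq σ] (A : σ → ℤ) (j : σ) (m : ℕ) :
    d j ^ m * euler A = euler A * d j ^ m + (A j * m) • d j ^ m := by
  have h : ∀ k, d j ^ m * A k • (x k * d k) =
      A k • (x k * d k) * d j ^ m + if k = j then (A k * m) • d j ^ m else 0 := by
    intro k
    split_ifs with hk
    · subst hk
      rw [mul_smul_comm, ← mul_assoc, d_pow_mul_x_self, add_mul, smul_add, smul_mul_assoc,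
        smul_mul_assoc, mul_assoc, mul_assoc, ← pow_succ, ← pow_succ']
      rcases m with _ | m
      · simp
      · rw [Nat.add_sub_cancel, mul_smul, natCast_zsmul, ← pow_succ]
    · have hd : d j ^ m * d k = d k * d j ^ m :=
        (show Commute (d j) (d k) from d_mul_d _ _).pow_left m
      rw [add_zero, mul_smul_comm, ← mul_assoc, d_pow_mul_x_of_ne (Ne.symm hk), smul_mul_assoc,
        mul_assoc, mul_assoc, hd]
  rw [euler, Finset.mul_sum, Finset.sum_mul, Finset.sum_congr rfl fun k _ => h k,
    Finset.sum_add_distrib, Finset.sum_ite_eq' Finset.univ j]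
  simp

/-! ### Normal forms modulo `x_i D` -/

/-- The additive section `D'[∂ i] → D` of the quotient of `D` by `x i D`. -/
def normalForm (i : σ) :
    (WeylAlgebra {j : σ // j ≠ i})[X] →+ WeylAlgebra σ :=
  Polynomial.eval₂AddMonoidHom (incl i).toRingHom (d i)

theorem normalForm_apply (i : σ) (P : (WeylAlgebra {j : σ // j ≠ i})[X]) :
    normalForm i P = P.eval₂ (incl i).toRingHom (d i) := rfl

theorem exists_normalForm_sub_incl_eval (i : σ) (r : WeylAlgebra {j : σ // j ≠ i})
    (P : (WeylAlgebra {j : σ // j ≠ i})[X]) :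
    ∃ q, normalForm i P = incl i (P.eval r) + q * (d i - incl i r) := by
  induction P using Polynomial.induction_on' with
  | add P Q hP hQ =>
    obtain ⟨q, hq⟩ := hP
    obtain ⟨q', hq'⟩ := hQ
    refine ⟨q + q', ?_⟩
    rw [map_add, hq, hq', Polynomial.eval_add, map_add, add_mul]
    abel
  | monomial m a =>
    -- `∂_i` commutes with `D'`, so `∂_i ^ m - r ^ m` is the geometric sum times `∂_i - r`.
    refine ⟨incl i a * ∑ k ∈ Finset.range m, d i ^ k * incl i r ^ (m - 1 - k), ?_⟩
    rw [mul_assoc, (commute_d_incl i r).geom_sum₂_mul, normalForm_apply,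
      Polynomial.eval₂_monomial, Polynomial.eval_monomial, map_mul, map_pow, mul_sub]
    change incl i a * _ = _
    abel

/-! ### The right `D`-module `D / x_i D` and evaluation at `∂_i = r` -/

section rightAction

variable [DecidableEq σ] (i : σ)

/-- The right action of `x j` on `D'[∂ i]`, the quotient of `D` by `x i D`. -/
def actX (j : σ) :
    Module.End (WeylAlgebra {j : σ // j ≠ i}) (WeylAlgebra {j : σ // j ≠ i})[X] :=
  if h : j = i then derivative else LinearMap.mulRight _ (C (x ⟨j, h⟩))

/-- The right action of `∂ j` on `D'[∂ i]`, the quotient of `D` by `x i D`. -/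
def actD (j : σ) :
    Module.End (WeylAlgebra {j : σ // j ≠ i}) (WeylAlgebra {j : σ // j ≠ i})[X] :=
  if h : j = i then LinearMap.mulRight _ X else LinearMap.mulRight _ (C (d ⟨j, h⟩))

theorem actX_self : actX i i = derivative := dif_pos rfl

theorem actX_of_ne {j : σ} (h : j ≠ i) : actX i j = LinearMap.mulRight _ (C (x ⟨j, h⟩)) :=
  dif_neg h

theorem actD_self : actD i i = LinearMap.mulRight _ X := dif_pos rfl

theorem actD_of_ne {j : σ} (h : j ≠ i) : actD i j = LinearMap.mulRight _ (C (d ⟨j, h⟩)) :=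
  dif_neg h

/-- The right action of `D` on `D'[∂ i]`, the quotient of `D` by `x i D`. -/
def rightAction : WeylAlgebra σ →ₐ[ℂ]
    (Module.End (WeylAlgebra {j : σ // j ≠ i}) (WeylAlgebra {j : σ // j ≠ i})[X])ᵐᵒᵖ :=
  lift (fun j => op (actX i j)) (fun j => op (actD i j))
    (by
      intro j k
      rw [← MulOpposite.op_mul, ← MulOpposite.op_mul]
      congr 1
      refine LinearMap.ext fun P => ?_
      by_cases hj : j = i <;> by_cases hk : k = i <;>
        simp [actX, hj, hk, mul_assoc, ← Polynomial.C_mul, -map_mul, x_mul_x])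
    (by
      intro j k
      rw [← MulOpposite.op_mul, ← MulOpposite.op_mul]
      congr 1
      refine LinearMap.ext fun P => ?_
      by_cases hj : j = i <;> by_cases hk : k = i <;>
        simp [actD, hj, hk, mul_assoc, ← Polynomial.C_mul, -map_mul, d_mul_d])
    (by
      intro j k h
      rw [← MulOpposite.op_mul, ← MulOpposite.op_mul]
      congr 1
      refine LinearMap.ext fun P => ?_
      by_cases hj : j = i <;> by_cases hk : k = i
      · exact absurd (hj.trans hk.symm) h
      · simp [actD, actX, hj, hk, mul_assoc]
      · simp [actD, actX, hj, hk]
      · have h' : (⟨j, hj⟩ : {j : σ // j ≠ i}) ≠ ⟨k, hk⟩ := fun e => h (congrArg Subtype.val e)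
        simp [actD, actX, hj, hk, mul_assoc, ← Polynomial.C_mul, -map_mul, d_mul_x_of_ne h'])
    (by
      intro j
      rw [← MulOpposite.op_mul, ← MulOpposite.op_mul, ← MulOpposite.op_one, ← MulOpposite.op_add]
      congr 1
      refine LinearMap.ext fun P => ?_
      by_cases hj : j = i
      · simp [actD, actX, hj]
      · simp [actD, actX, hj, mul_assoc, ← Polynomial.C_mul, -map_mul, d_mul_x_self, mul_add])

/-- The right action of `p ∈ D` on `D'[∂ i]` as a `D'`-linear map. -/
def act (p : WeylAlgebra σ) :
    (WeylAlgebra {j : σ // j ≠ i})[X] →ₗ[WeylAlgebra {j : σ // j ≠ i}]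
      (WeylAlgebra {j : σ // j ≠ i})[X] :=
  unop (rightAction i p)

theorem act_x (j : σ) : act i (x j) = actX i j :=
  congrArg unop (lift_x _ _ _ _ _ _ j)

theorem act_d (j : σ) : act i (d j) = actD i j :=
  congrArg unop (lift_d _ _ _ _ _ _ j)

theorem act_mul (p q : WeylAlgebra σ) (P : (WeylAlgebra {j : σ // j ≠ i})[X]) :
    act i (p * q) P = act i q (act i p P) := by
  simp [act]

theorem act_add (p q : WeylAlgebra σ) : act i (p + q) = act i p + act i q := by
  simp [act]

theorem act_algebraMap (c : ℂ) (P : (WeylAlgebra {j : σ // j ≠ i})[X]) :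
    act i (algebraMap ℂ _ c) P = c • P := by
  simp only [act, AlgHom.commutes]
  rfl

theorem act_incl (q : WeylAlgebra {j : σ // j ≠ i}) (P : (WeylAlgebra {j : σ // j ≠ i})[X]) :
    act i (incl i q) P = P * C q := by
  induction q using induction_on generalizing P with
  | algebraMap c =>
    rw [AlgHom.commutes, act_algebraMap, ← Polynomial.algebraMap_apply, Algebra.smul_def,
      Algebra.commutes]
  | x j => rw [incl_x, act_x, actX_of_ne i j.2, LinearMap.mulRight_apply]
  | d j => rw [incl_d, act_d, actD_of_ne i j.2, LinearMap.mulRight_apply]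
  | mul p q hp hq => rw [map_mul, act_mul, hp, hq, Polynomial.C_mul, mul_assoc]
  | add p q hp hq => rw [map_add, act_add, LinearMap.add_apply, hp, hq, Polynomial.C_add, mul_add]

/-- The `D'`-linear map `D → D'` that kills `x i D` and replaces `∂ i` on the right by `r`. -/
def restrictMap (r : WeylAlgebra {j : σ // j ≠ i}) :
    WeylAlgebra σ →ₗ[WeylAlgebra {j : σ // j ≠ i}] WeylAlgebra {j : σ // j ≠ i} where
  toFun p := (act i p 1).eval r
  map_add' p q := by rw [act_add, LinearMap.add_apply, Polynomial.eval_add]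
  map_smul' q p := by
    rw [smul_def, act_mul, act_incl, one_mul, ← mul_one (C q), ← Polynomial.smul_eq_C_mul,
      map_smul, Polynomial.eval_smul, RingHom.id_apply]

theorem restrictMap_apply (r : WeylAlgebra {j : σ // j ≠ i}) (p : WeylAlgebra σ) :
    restrictMap i r p = (act i p 1).eval r := rfl

theorem restrictMap_one (r : WeylAlgebra {j : σ // j ≠ i}) : restrictMap i r 1 = 1 := by
  have h := act_algebraMap i 1 1
  rw [map_one (algebraMap ℂ (WeylAlgebra σ)), one_smul] at h
  rw [restrictMap_apply, h, Polynomial.eval_one]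

/-- In a right action the left factor `x_i` acts first, and it differentiates the constant `1`. -/
theorem restrictMap_x_mul (r : WeylAlgebra {j : σ // j ≠ i}) (p : WeylAlgebra σ) :
    restrictMap i r (x i * p) = 0 := by
  rw [restrictMap_apply, act_mul, act_x, actX_self, Polynomial.derivative_one, map_zero,
    Polynomial.eval_zero]

theorem restrictMap_mul_d_self (r : WeylAlgebra {j : σ // j ≠ i}) (p : WeylAlgebra σ) :
    restrictMap i r (p * d i) = restrictMap i r p * r := by
  rw [restrictMap_apply, act_mul, act_d, actD_self, LinearMap.mulRight_apply,
    Polynomial.eval_mul_X, restrictMap_apply]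

/-- Evaluation puts `r` to the right of the coefficients, so a right factor `q` can be pulled out
once it commutes with `r`. The Euler operator need not commute with `r` and is treated separately.
-/
theorem restrictMap_mul_incl {r q : WeylAlgebra {j : σ // j ≠ i}} (h : Commute r q)
    (p : WeylAlgebra σ) :
    restrictMap i r (p * incl i q) = restrictMap i r p * q := by
  rw [restrictMap_apply, act_mul, act_incl, restrictMap_apply]
  exact Polynomial.eval₂_mul_C' _ _ h.symm

/-- Shows that the formal action is right multiplication modulo `x_i D`. The derivative comes from
`∂_i ^ k x_i = x_i ∂_i ^ k + k ∂_i ^ (k - 1)`, whose first term lands in `x_i D` because `x_i`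
commutes with `D'`. -/
theorem exists_normalForm_mul (p : WeylAlgebra σ) (P : (WeylAlgebra {j : σ // j ≠ i})[X]) :
    ∃ q, normalForm i P * p = normalForm i (act i p P) + x i * q := by
  have hC : ∀ (q : WeylAlgebra {j : σ // j ≠ i}) (P : (WeylAlgebra {j : σ // j ≠ i})[X]),
      normalForm i (P * C q) = normalForm i P * incl i q := fun q P =>
    Polynomial.eval₂_mul_C' _ _ (commute_d_incl i q).symm
  induction p using induction_on generalizing P with
  | algebraMap c =>
    refine ⟨0, ?_⟩
    rw [← AlgHom.commutes (incl i), act_incl, hC, mul_zero, add_zero]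
  | x j =>
    by_cases hj : j = i
    · subst hj
      rw [act_x, actX_self]
      induction P using Polynomial.induction_on' with
      | add P Q hP hQ =>
        obtain ⟨q, hq⟩ := hP
        obtain ⟨q', hq'⟩ := hQ
        refine ⟨q + q', ?_⟩
        rw [map_add, map_add, map_add, add_mul, hq, hq', mul_add]
        abel
      | monomial m a =>
        refine ⟨incl j a * d j ^ m, ?_⟩
        rw [Polynomial.derivative_monomial, normalForm_apply, normalForm_apply,
          Polynomial.eval₂_monomial, Polynomial.eval₂_monomial]
        change incl j a * d j ^ m * x j = incl j (a * m) * d j ^ (m - 1) + _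
        rw [mul_assoc, d_pow_mul_x_self, mul_add, ← mul_assoc, ← mul_assoc, x_mul_incl, map_mul,
          map_natCast, nsmul_eq_mul, mul_assoc (incl j a) (m : WeylAlgebra σ), add_comm]
    · refine ⟨0, ?_⟩
      rw [act_x, actX_of_ne i hj, LinearMap.mulRight_apply, hC, incl_x, mul_zero, add_zero]
  | d j =>
    refine ⟨0, ?_⟩
    by_cases hj : j = i
    · subst hj
      rw [act_d, actD_self, LinearMap.mulRight_apply, mul_zero, add_zero]
      exact (Polynomial.eval₂_mul_X _ _).symm
    · rw [act_d, actD_of_ne i hj, LinearMap.mulRight_apply, hC, incl_d, mul_zero, add_zero]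
  | mul p q hp hq =>
    obtain ⟨p', hp⟩ := hp P
    obtain ⟨q', hq⟩ := hq (act i p P)
    refine ⟨q' + p' * q, ?_⟩
    rw [← mul_assoc, hp, add_mul, hq, act_mul, mul_add]
    simp only [mul_assoc, add_assoc]
  | add p q hp hq =>
    obtain ⟨p', hp⟩ := hp P
    obtain ⟨q', hq⟩ := hq P
    refine ⟨p' + q', ?_⟩
    rw [mul_add, hp, hq, act_add, LinearMap.add_apply, map_add, mul_add]
    abel

/-- Every operator is congruent to its image under `restrictMap`, modulo `D (∂ i - r) + x i D`. -/
theorem exists_eq_incl_restrictMap (r : WeylAlgebra {j : σ // j ≠ i}) (p : WeylAlgebra σ) :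
    ∃ q q', p = incl i (restrictMap i r p) + q * (d i - incl i r) + x i * q' := by
  obtain ⟨q', hq'⟩ := exists_normalForm_mul i p 1
  obtain ⟨q, hq⟩ := exists_normalForm_sub_incl_eval i r (act i p 1)
  have h1 : normalForm i 1 = 1 := Polynomial.eval₂_one _ _
  exact ⟨q, q', by rw [restrictMap_apply, ← hq, ← hq', h1, one_mul]⟩

end rightAction

/-! ### Operators with constant coefficients -/

/-- The inclusion of the operators with constant coefficients not involving `∂ i`. -/
def inclConst (i : σ) : constCoeff {j : σ // j ≠ i} →+* constCoeff σ :=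
  (((incl i).comp (constCoeff {j : σ // j ≠ i}).val).codRestrict (constCoeff σ) (by
    rintro ⟨c, hc⟩
    have h : (constCoeff {j : σ // j ≠ i}).map (incl i) ≤ constCoeff σ := by
      rw [constCoeff, AlgHom.map_adjoin]
      refine Algebra.adjoin_mono ?_
      rintro _ ⟨_, ⟨j, rfl⟩, rfl⟩
      exact ⟨j, (incl_d i j).symm⟩
    exact h ⟨c, hc, rfl⟩)).toRingHom

theorem inclConst_dConst (i : σ) (j : {j : σ // j ≠ i}) :
    inclConst i (dConst j) = dConst j.1 :=
  Subtype.ext (incl_d i j)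

theorem coe_mul_comm_constCoeff (b c : constCoeff σ) :
    (b : WeylAlgebra σ) * c = c * b :=
  congrArg Subtype.val (mul_comm b c)

/-- The element `b'` is `b` after `∂_i ↦ ∂_o ^ m`; the substitution works because `ℂ[∂']` is
commutative and contains `r`. It handles arbitrary multipliers of the toric binomials. -/
theorem exists_restrictMap_mul_eq [DecidableEq σ] (i : σ) (o : {j : σ // j ≠ i}) (m : ℕ) (b : constCoeff σ) :
    ∃ b' : constCoeff {j : σ // j ≠ i}, ∀ p,
      restrictMap i (d o ^ m) (p * b) = restrictMap i (d o ^ m) p * b' := by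
  obtain ⟨b, hb⟩ := b
  induction hb using Algebra.adjoin_induction with
  | mem b hb =>
    obtain ⟨j, rfl⟩ := hb
    by_cases hj : j = i
    · subst hj
      exact ⟨dConst o ^ m, fun p => restrictMap_mul_d_self _ _ _⟩
    · refine ⟨dConst ⟨j, hj⟩, fun p => ?_⟩
      change restrictMap i (d o ^ m) (p * d j) = _
      rw [← incl_d i ⟨j, hj⟩, restrictMap_mul_incl]
      · rfl
      · exact coe_mul_comm_constCoeff (dConst o ^ m) (dConst _)
  | algebraMap c =>
    refine ⟨algebraMap ℂ _ c, fun p => ?_⟩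
    change restrictMap i (d o ^ m) (p * algebraMap ℂ _ c) = _ * algebraMap ℂ _ c
    rw [← AlgHom.commutes (incl i), restrictMap_mul_incl]
    exact (Algebra.commutes c _).symm
  | add b c _ _ hb hc =>
    obtain ⟨b', hb⟩ := hb
    obtain ⟨c', hc⟩ := hc
    refine ⟨b' + c', fun p => ?_⟩
    change restrictMap i (d o ^ m) (p * (b + c)) = _ * (b' + c')
    rw [mul_add, map_add, hb, hc, mul_add]
  | mul b c _ _ hb hc =>
    obtain ⟨b', hb⟩ := hb
    obtain ⟨c', hc⟩ := hc
    refine ⟨b' * c', fun p => ?_⟩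
    change restrictMap i (d o ^ m) (p * (b * c)) = _ * (b' * c')
    rw [← mul_assoc, hc, hb, mul_assoc]

/-! ### Generators of the GKZ ideals under the substitution -/

section gkz

variable [Fintype σ] [DecidableEq σ]

theorem euler_eq_add_incl (A : σ → ℤ) (i : σ) :
    euler A = A i • (x i * d i) + incl i (euler fun j => A j) := by
  rw [euler, Fintype.sum_eq_add_sum_subtype_ne _ i, euler, map_sum]
  congr 1
  refine Finset.sum_congr rfl fun j _ => ?_
  rw [map_zsmul, map_mul, incl_x, incl_d]

theorem prod_dConst_pow (i : σ) (u : σ → ℕ) :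
    ∏ j, dConst j ^ u j =
      dConst i ^ u i * inclConst i (∏ j : {j : σ // j ≠ i}, dConst j ^ u j) := by
  rw [Fintype.prod_eq_mul_prod_subtype_ne _ i, map_prod]
  congr 1
  refine Finset.prod_congr rfl fun j _ => ?_
  rw [map_pow, inclConst_dConst]

theorem dConst_pow_mul_prod (o : σ) (k : ℕ) (u : σ → ℕ) :
    dConst o ^ k * ∏ j, dConst j ^ u j = ∏ j, dConst j ^ (u j + if j = o then k else 0) := by
  simp only [pow_add, Finset.prod_mul_distrib, pow_ite, pow_zero]
  rw [Finset.prod_ite_eq' Finset.univ o, if_pos (Finset.mem_univ o), mul_comm]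

/-- Under `restrictMap`, right multiplication by a monomial in `∂` becomes right multiplication by
the monomial obtained by the substitution `∂ i ↦ (∂ o) ^ m`. -/
theorem restrictMap_mul_prod (i : σ) (o : {j : σ // j ≠ i}) (m : ℕ) (p : WeylAlgebra σ)
    (u : σ → ℕ) :
    restrictMap i (d o ^ m) (p * (∏ j, dConst j ^ u j : constCoeff σ)) =
      restrictMap i (d o ^ m) p *
        (∏ j : {j : σ // j ≠ i}, dConst j ^ (u j + if j = o then m * u i else 0) :
          constCoeff {j : σ // j ≠ i}) := by
  have hd : ∀ k : ℕ, restrictMap i (d o ^ m) (p * d i ^ k) =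
      restrictMap i (d o ^ m) p * d o ^ (m * k) := by
    intro k
    induction k with
    | zero => simp
    | succ k ih =>
      rw [pow_succ, ← mul_assoc, restrictMap_mul_d_self, ih, mul_assoc, ← pow_add, mul_add_one]
  rw [prod_dConst_pow i, ← dConst_pow_mul_prod]
  change restrictMap i (d o ^ m) (p * (d i ^ u i * incl i _)) =
    restrictMap i (d o ^ m) p * (d o ^ (m * u i) * _)
  rw [← mul_assoc, restrictMap_mul_incl, hd, mul_assoc]
  · rfl
  exact coe_mul_comm_constCoeff (dConst o ^ m) _

variable {A : σ → ℤ} {i : σ} {o : {j : σ // j ≠ i}} {m : ℕ}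

/-- The operators `∂_i` and `∂_o ^ m` have the same `A`-degree, so the substitution takes toric
binomials to toric binomials. -/
theorem exists_mem_toricIdeal_restrictMap (ho : A o = 1) (hm : A i = m) {b : constCoeff σ}
    (hb : b ∈ toricIdeal A) :
    ∃ b' ∈ toricIdeal (fun j : {j : σ // j ≠ i} => A j), ∀ p,
      restrictMap i (d o ^ m) (p * b) = restrictMap i (d o ^ m) p * b' := by
  induction hb using Submodule.span_induction with
  | mem b hb =>
    obtain ⟨u, v, huv, rfl⟩ := hb
    -- The exponent `m w_i` added at `o` has weight `a_o m w_i`, which replaces the lost term `a_i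
    -- w_i`.
    have hsum : ∀ w : σ → ℕ, ∑ j : {j : σ // j ≠ i},
        A j * ((w j + if j = o then m * w i else 0 : ℕ) : ℤ) = ∑ j, A j * (w j : ℤ) := by
      intro w
      rw [Fintype.sum_eq_add_sum_subtype_ne _ i]
      simp [mul_add, Finset.sum_add_distrib, ho, hm, add_comm]
    refine ⟨_, Ideal.subset_span ⟨_, _, ((hsum u).trans huv).trans (hsum v).symm, rfl⟩,
      fun p => ?_⟩
    have hsub : ∀ {τ : Type _} (b c : constCoeff τ),
      ((b - c : constCoeff τ) : WeylAlgebra τ) = b - c := fun _ _ => rfl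
    rw [hsub, hsub, mul_sub, map_sub, restrictMap_mul_prod, restrictMap_mul_prod, mul_sub]
  | zero => exact ⟨0, zero_mem _, fun p => by
      change restrictMap i (d o ^ m) (p * 0) = _ * 0
      rw [mul_zero, map_zero, mul_zero]⟩
  | add b c _ _ hb hc =>
    obtain ⟨b', hb', hb⟩ := hb
    obtain ⟨c', hc', hc⟩ := hc
    refine ⟨b' + c', add_mem hb' hc', fun p => ?_⟩
    change restrictMap i (d o ^ m) (p * (b + c)) = _ * (b' + c')
    rw [mul_add, map_add, hb, hc, mul_add]
  | smul c b _ hb =>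
    obtain ⟨b', hb', hb⟩ := hb
    obtain ⟨c', hc⟩ := exists_restrictMap_mul_eq i o m c
    refine ⟨c' * b', Ideal.mul_mem_left _ _ hb', fun p => ?_⟩
    change restrictMap i (d o ^ m) (p * (c * b)) = _ * (c' * b')
    rw [← mul_assoc, hb, hc, mul_assoc]

/-- On `a ∂_i ^ k` the term `a_i x_i ∂_i` acts by the factor `a_i k`, while moving `r ^ k` past the
Euler operator of `A'` produces `a_o m k`. These agree since `a_o = 1` and `a_i = m`. -/
theorem restrictMap_mul_euler (ho : A o = 1) (hm : A i = m) (p : WeylAlgebra σ) :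
    restrictMap i (d o ^ m) (p * euler A) =
      restrictMap i (d o ^ m) p * euler fun j : {j : σ // j ≠ i} => A j := by
  rw [restrictMap_apply, act_mul, restrictMap_apply]
  generalize act i p 1 = P
  have hP : act i (euler A) P =
      A i • (derivative P * X) + P * C (euler fun j : {j : σ // j ≠ i} => A j) := by
    rw [euler_eq_add_incl A i, act_add, LinearMap.add_apply, act_incl]
    congr 1
    rw [← Int.cast_smul_eq_zsmul ℂ, Algebra.smul_def, Algebra.commutes, act_mul, act_algebraMap,
      act_mul, act_x, act_d, actX_self, actD_self, LinearMap.mulRight_apply,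
      Int.cast_smul_eq_zsmul]
  rw [hP]
  clear hP
  induction P using Polynomial.induction_on' with
  | add P Q hP hQ =>
    rw [Polynomial.eval_add (p := P), add_mul (Polynomial.eval _ P), ← hP, ← hQ,
      ← Polynomial.eval_add, map_add, add_mul, add_mul, smul_add]
    congr 1
    abel
  | monomial k a =>
    -- The factor `k` is kept because for `k = 0` the truncated exponent `k - 1` is wrong.
    have hk : (k : WeylAlgebra {j : σ // j ≠ i}) * ((d o ^ m) ^ (k - 1) * d o ^ m) =
        k * (d o ^ m) ^ k := by
      rcases k with _ | k
      · simp
      · rw [Nat.add_sub_cancel, ← pow_succ]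
    rw [Polynomial.eval_add, Polynomial.eval_smul, Polynomial.eval_mul_X,
      Polynomial.derivative_monomial, Polynomial.eval_monomial, Polynomial.monomial_mul_C,
      Polynomial.eval_monomial, Polynomial.eval_monomial, mul_assoc a (_ ^ k), mul_assoc _ _ (d o ^ m), mul_assoc,
      hk, ← pow_mul, d_pow_mul_euler, ho, hm, mul_add, add_comm, mul_assoc a (euler _)]
    congr 1
    rw [← mul_smul_comm]
    congr 1
    rw [← nsmul_eq_mul, ← natCast_zsmul, smul_smul, one_mul, Nat.cast_mul]

theorem inclConst_mem_toricIdeal {b : constCoeff {j : σ // j ≠ i}}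
    (hb : b ∈ toricIdeal fun j : {j : σ // j ≠ i} => A j) : inclConst i b ∈ toricIdeal A := by
  have h : toricIdeal (fun j : {j : σ // j ≠ i} => A j) ≤ (toricIdeal A).comap (inclConst i) := by
    refine Ideal.span_le.2 ?_
    rintro _ ⟨u, v, huv, rfl⟩
    -- Exponents are extended by zero at `i`.
    have hext : ∀ w : {j : σ // j ≠ i} → ℕ,
        ∃ w' : σ → ℕ, w' i = 0 ∧ ∀ j : {j // j ≠ i}, w' j = w j :=
      fun w => ⟨fun j => if h : j = i then 0 else w ⟨j, h⟩, dif_pos rfl, fun j => dif_neg j.2⟩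
    obtain ⟨u', hu0, hu⟩ := hext u
    obtain ⟨v', hv0, hv⟩ := hext v
    refine Ideal.subset_span ⟨u', v', ?_, ?_⟩
    · rw [Fintype.sum_eq_add_sum_subtype_ne _ i,
        Fintype.sum_eq_add_sum_subtype_ne (fun j => A j * (v' j : ℤ)) i]
      simpa [hu0, hv0, hu, hv] using huv
    · rw [prod_dConst_pow i u', prod_dConst_pow i v']
      simp [hu0, hv0, hu, hv]
  exact h hb

/-- This is the relation that eliminates `∂_i`; it exists because `a_o = 1` and `a_i` is a natural
number. -/
theorem dConst_sub_pow_mem_toricIdeal (ho : A o = 1) (hm : A i = m) :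
    dConst i - inclConst i (dConst o ^ m) ∈ toricIdeal A := by
  refine Ideal.subset_span ⟨Pi.single i 1, Pi.single o.1 m, ?_, ?_⟩
  · simp [Pi.single_apply, ho, hm]
  · simp [Pi.single_apply, inclConst_dConst]

end gkz

end WeylAlgebra

/-! ### The quotient isomorphism, abstractly -/

theorem mem_leftAddRight_of_mem {R S : Type*} [Ring R] [Ring S] [Module R S]
    [IsScalarTower R S S] {J : Submodule S S} {y : S}
    (hy : ∀ (r : R) (p : S), y * (r • p) = r • (y * p)) {p : S} (hp : p ∈ J) :
    p ∈ leftAddRight R J y hy :=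
  ⟨p, hp, 0, by rw [mul_zero, add_zero]⟩

/-- An `R`-linear map `φ : S → R` that sends `1` to `1` and kills `y S` identifies the quotient of
`S` by the left ideal spanned by `s`, plus `y S`, with the quotient of `R` by the left ideal spanned
by `t`, if it turns right multiplication by elements of `s` into right multiplication by elements
of the latter, and if the quotient of `S` is generated by `1` with annihilator containing `t`. -/
def quotientLeftAddRightEquiv {R S : Type*} [Ring R] [Ring S] [Module R S]
    [IsScalarTower R S S] (s : Set S) (t : Set R) {y : S}
    (hy : ∀ (r : R) (p : S), y * (r • p) = r • (y * p)) (φ : S →ₗ[R] R) (h_one : φ 1 = 1)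
    (hφy : ∀ p, φ (y * p) = 0)
    (hs : ∀ g ∈ s, ∃ g' ∈ Submodule.span R t, ∀ p, φ (p * g) = φ p * g')
    (ht : ∀ g ∈ t, g • (1 : S) ∈ leftAddRight R (Submodule.span S s) y hy)
    (hφ : ∀ p, p - φ p • (1 : S) ∈ leftAddRight R (Submodule.span S s) y hy) :
    (S ⧸ leftAddRight R (Submodule.span S s) y hy) ≃ₗ[R] R ⧸ Submodule.span R t :=
  LinearEquiv.ofLinearMap
    (Submodule.mapQ _ _ φ (by
      rintro _ ⟨h, hh, q, rfl⟩
      -- `φ` is linear only over `R`, so a left multiplier from `S` cannot be pulled out;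
      -- quantifying over `p` absorbs it.
      have key : ∀ p, φ (p * h) ∈ Submodule.span R t := by
        induction hh using Submodule.span_induction with
        | mem g hg =>
          obtain ⟨g', hg', hgg'⟩ := hs g hg
          intro p
          rw [hgg']
          exact Submodule.smul_mem _ (φ p) hg'
        | zero =>
          intro p
          rw [mul_zero, map_zero]
          exact zero_mem _
        | add g h _ _ hg hh =>
          intro p
          rw [mul_add, map_add]
          exact add_mem (hg p) (hh p)
        | smul c h _ hh =>
          intro p
          rw [smul_eq_mul, ← mul_assoc]
          exact hh _
      have h1 := key 1
      rw [one_mul] at h1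
      rwa [Submodule.mem_comap, map_add, hφy, add_zero]))
    (Submodule.mapQ _ _ (LinearMap.toSpanSingleton R S 1) (Submodule.span_le.2 ht))
    (by
      ext
      simp [h_one])
    (by
      refine Submodule.linearMap_qext _ (LinearMap.ext fun p => ?_)
      exact ((Submodule.Quotient.eq _).2 (hφ p)).symm)

/-! ### Coefficientwise extension to polynomials in `s` -/

namespace WeylAlgebra

theorem coeff_sum_monomial_map {σ : Type*} {i : σ}
    (φ : WeylAlgebra σ →ₗ[WeylAlgebra {j : σ // j ≠ i}] WeylAlgebra {j : σ // j ≠ i})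
    (P : (WeylAlgebra σ)[X]) (n : ℕ) :
    (∑ k ∈ P.support, Polynomial.monomial k (φ (P.coeff k))).coeff n = φ (P.coeff n) := by
  rw [Polynomial.finsetSum_coeff]
  simp only [Polynomial.coeff_monomial]
  rw [Finset.sum_ite_eq']
  split_ifs with h
  · rfl
  · rw [Polynomial.notMem_support_iff.1 h, map_zero]

/-- The extension of a `D'`-linear map `D → D'` to polynomials in the central variable `s`. -/
def polyExtend {σ : Type*} {i : σ}
    (φ : WeylAlgebra σ →ₗ[WeylAlgebra {j : σ // j ≠ i}] WeylAlgebra {j : σ // j ≠ i}) :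
    (WeylAlgebra σ)[X] →ₗ[(WeylAlgebra {j : σ // j ≠ i})[X]]
      (WeylAlgebra {j : σ // j ≠ i})[X] :=
  { toFun := fun P => ∑ k ∈ P.support, Polynomial.monomial k (φ (P.coeff k))
    map_add' := fun P Q => by
      ext n
      rw [Polynomial.coeff_add, coeff_sum_monomial_map, coeff_sum_monomial_map,
        coeff_sum_monomial_map, Polynomial.coeff_add, map_add]
    map_smul' := fun R P => by
      ext n
      rw [RingHom.id_apply, smul_eq_mul, Polynomial.coeff_mul, coeff_sum_monomial_map,
        poly_smul_def, Polynomial.coeff_mul, map_sum]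
      refine Finset.sum_congr rfl fun k _ => ?_
      rw [coeff_sum_monomial_map, Polynomial.coe_mapRingHom, Polynomial.coeff_map]
      exact map_smul φ (R.coeff k.1) (P.coeff k.2) }

section polyExtend

variable {σ : Type*} {i : σ}
  (φ : WeylAlgebra σ →ₗ[WeylAlgebra {j : σ // j ≠ i}] WeylAlgebra {j : σ // j ≠ i})

theorem coeff_polyExtend (P : (WeylAlgebra σ)[X]) (n : ℕ) :
    (polyExtend φ P).coeff n = φ (P.coeff n) :=
  coeff_sum_monomial_map φ P n

theorem polyExtend_monomial (n : ℕ) (p : WeylAlgebra σ) :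
    polyExtend φ (Polynomial.monomial n p) = Polynomial.monomial n (φ p) := by
  ext k
  rw [coeff_polyExtend, Polynomial.coeff_monomial, Polynomial.coeff_monomial, apply_ite φ,
    map_zero]

theorem polyExtend_mul_C {g : WeylAlgebra σ} {g' : WeylAlgebra {j : σ // j ≠ i}}
    (h : ∀ p, φ (p * g) = φ p * g') (P : (WeylAlgebra σ)[X]) :
    polyExtend φ (P * C g) = polyExtend φ P * C g' := by
  ext n
  rw [coeff_polyExtend, Polynomial.coeff_mul_C, h, Polynomial.coeff_mul_C, coeff_polyExtend]

theorem polyExtend_mul_X (P : (WeylAlgebra σ)[X]) :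
    polyExtend φ (P * X) = polyExtend φ P * X := by
  ext n
  rw [coeff_polyExtend]
  cases n with
  | zero => simp
  | succ n => rw [Polynomial.coeff_mul_X, Polynomial.coeff_mul_X, coeff_polyExtend]

end polyExtend

/-! ### The restriction isomorphisms -/

variable {σ : Type*} [Fintype σ] [DecidableEq σ] {A : σ → ℤ} {i : σ} {o : {j : σ // j ≠ i}} {m : ℕ}

/-- The two Euler operators differ by an element of `x_i D`, which puts the Euler generator for `A'`
in `H_A + x_i D`. -/
theorem incl_euler (A : σ → ℤ) (i : σ) :
    incl i (euler fun j => A j) = euler A + x i * (-(A i • d i)) := by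
  rw [euler_eq_add_incl A i, mul_neg, mul_smul_comm]
  abel

/-- The restriction of a GKZ system to `x i = 0`. -/
def restrictionEquiv (ho : A o = 1) (hm : A i = m) (β : ℂ) :
    Restriction A β i ≃ₗ[WeylAlgebra {j : σ // j ≠ i}]
      (WeylAlgebra {j : σ // j ≠ i} ⧸ gkz (fun j : {j : σ // j ≠ i} => A j) β) :=
  quotientLeftAddRightEquiv _ _ (x_mul_smul i) (restrictMap i (d o ^ m)) (restrictMap_one i _)
    (restrictMap_x_mul i _)
    (by
      rintro _ (⟨b, hb, rfl⟩ | rfl)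
      · obtain ⟨b', hb', h⟩ := exists_mem_toricIdeal_restrictMap ho hm hb
        exact ⟨b', Submodule.subset_span (Or.inl ⟨b', hb', rfl⟩), h⟩
      · refine ⟨_, Submodule.subset_span (Or.inr rfl), fun p => ?_⟩
        rw [mul_sub, map_sub, restrictMap_mul_euler ho hm, ← AlgHom.commutes (incl i),
          restrictMap_mul_incl i (Algebra.commutes β _).symm, mul_sub])
    (by
      rintro _ (⟨b, hb, rfl⟩ | rfl)
      · rw [smul_def, mul_one]
        exact mem_leftAddRight_of_mem _
          (Submodule.subset_span (Or.inl ⟨_, inclConst_mem_toricIdeal hb, rfl⟩))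
      · refine ⟨_, Submodule.subset_span (Or.inr rfl), -(A i • d i), ?_⟩
        rw [smul_def, mul_one, map_sub, incl_euler, AlgHom.commutes]
        abel)
    (by
      intro p
      obtain ⟨q, q', h⟩ := exists_eq_incl_restrictMap i (d o ^ m) p
      refine ⟨q * (d i - incl i (d o ^ m)), ?_, q', ?_⟩
      · exact Submodule.smul_mem _ q
          (Submodule.subset_span (Or.inl ⟨_, dConst_sub_pow_mem_toricIdeal ho hm, rfl⟩))
      · rw [smul_def, mul_one, sub_eq_iff_eq_add, add_comm, ← add_assoc]
        exact h)

/-- The restriction to `x i = 0` of a GKZ system with an indeterminate parameter. -/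
def restrictionPolyEquiv (ho : A o = 1) (hm : A i = m) :
    RestrictionPoly A i ≃ₗ[(WeylAlgebra {j : σ // j ≠ i})[X]]
      ((WeylAlgebra {j : σ // j ≠ i})[X] ⧸ gkzPoly (fun j : {j : σ // j ≠ i} => A j)) :=
  quotientLeftAddRightEquiv _ _ (C_x_mul_smul i) (polyExtend (restrictMap i (d o ^ m)))
    (by rw [← Polynomial.monomial_zero_one, polyExtend_monomial, restrictMap_one,
      Polynomial.monomial_zero_one])
    (by
      intro P
      ext n
      rw [coeff_polyExtend, Polynomial.coeff_C_mul, restrictMap_x_mul, Polynomial.coeff_zero])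
    (by
      rintro _ (⟨b, hb, rfl⟩ | rfl)
      · obtain ⟨b', hb', h⟩ := exists_mem_toricIdeal_restrictMap ho hm hb
        exact ⟨C b', Submodule.subset_span (Or.inl ⟨b', hb', rfl⟩), polyExtend_mul_C _ h⟩
      · refine ⟨_, Submodule.subset_span (Or.inr rfl), fun P => ?_⟩
        rw [mul_sub, map_sub, polyExtend_mul_C _ (restrictMap_mul_euler ho hm), polyExtend_mul_X,
          mul_sub])
    (by
      rintro _ (⟨b, hb, rfl⟩ | rfl)
      · rw [poly_smul_def, mul_one, Polynomial.coe_mapRingHom, Polynomial.map_C]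
        exact mem_leftAddRight_of_mem _
          (Submodule.subset_span (Or.inl ⟨_, inclConst_mem_toricIdeal hb, rfl⟩))
      · refine ⟨_, Submodule.subset_span (Or.inr rfl), C (-(A i • d i)), ?_⟩
        rw [poly_smul_def, mul_one, map_sub, Polynomial.coe_mapRingHom, Polynomial.map_C,
          Polynomial.map_X, ← Polynomial.C_mul]
        change C (incl i _) - X = _
        rw [incl_euler, Polynomial.C_add]
        abel)
    (by
      intro P
      induction P using Polynomial.induction_on' with
      | add P Q hP hQ =>
        rw [map_add, add_smul, add_sub_add_comm]
        exact add_mem hP hQ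
      | monomial n p =>
        obtain ⟨q, q', h⟩ := exists_eq_incl_restrictMap i (d o ^ m) p
        refine ⟨Polynomial.monomial n q * C (d i - incl i (d o ^ m)), ?_,
          Polynomial.monomial n q', ?_⟩
        · exact Submodule.smul_mem _ (Polynomial.monomial n q)
            (Submodule.subset_span (Or.inl ⟨_, dConst_sub_pow_mem_toricIdeal ho hm, rfl⟩))
        · rw [poly_smul_def, mul_one, polyExtend_monomial, Polynomial.coe_mapRingHom,
            Polynomial.map_monomial, Polynomial.monomial_mul_C, Polynomial.C_mul_monomial,
            ← map_sub, ← map_add]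
          congr 1
          rw [sub_eq_iff_eq_add, add_comm, ← add_assoc]
          exact h)

end WeylAlgebra

end

theorem mainTheorem3 (n : ℕ) (a : Fin (n + 1) → ℤ) (ha : a 0 = 1) (hmono : StrictMono a)
    (i : Fin (n + 1)) (hi : i ≠ 0) :
    Nonempty (WeylAlgebra.RestrictionPoly a i ≃ₗ[(WeylAlgebra {j : Fin (n + 1) // j ≠ i})[X]]
        ((WeylAlgebra {j : Fin (n + 1) // j ≠ i})[X] ⧸
          WeylAlgebra.gkzPoly (fun j : {j : Fin (n + 1) // j ≠ i} => a j))) ∧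
    ∀ β : ℂ,
      Nonempty (WeylAlgebra.Restriction a β i ≃ₗ[WeylAlgebra {j : Fin (n + 1) // j ≠ i}]
        (WeylAlgebra {j : Fin (n + 1) // j ≠ i} ⧸
          WeylAlgebra.gkz (fun j : {j : Fin (n + 1) // j ≠ i} => a j) β)) := by
  -- The exponent `m` must be a natural number; monotonicity gives `a_i ≥ a_0 = 1`.
  have h : a i = ((a i).toNat : ℕ) := by
    have := hmono.monotone (Fin.zero_le i)
    omega
  exact ⟨⟨WeylAlgebra.restrictionPolyEquiv (o := ⟨0, hi.symm⟩) ha h⟩,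
    fun β => ⟨WeylAlgebra.restrictionEquiv (o := ⟨0, hi.symm⟩) ha h β⟩⟩
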